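/- Let $m,n\ge 4$ be integers and let $a\in\mathbb{R}$ satisfy $a=3$ or $a>5$. Let $\{e_i\}_{i=0}^{m-1}$ and $\{f_j\}_{j=0}^{n-1}$ be the canonical bases of $\mathbb{C}^m$ and $\mathbb{C}^n$. The Schmidt rank of a vector $\psi\in\mathbb{C}^m\otimes\mathbb{C}^n$ is the minimal $k$ for which $\psi=\sum_{l=1}^{k}\alpha_l\,u_l\otimes v_l$ with real $\alpha_l>0$ and orthonormal families $(u_l)_{l=1}^k$ in $\mathbb{C}^m$ and $(v_l)_{l=1}^k$ in $\mathbb{C}^n$. For $2\le i\le m-2$ and $2\le j\le n-2$ put $$g_{i,j}=e_{i-2}\otimes f_{j+1}-a\,e_{i-1}\otimes f_j+a\,e_i\otimes f_{j-1}-e_{i+1}\otimes f_{j-2}.$$ For $0\le d\le N:=m+n-2$ let $\mathcal{S}^{(d)}$ be the complex span of the $g_{i,j}$ with $i+j=d+1$ (so $\mathcal{S}^{(d)}=\{0\}$ unless $3\le d\le N-3$), and let $\mathcal{S}$ be the complex span of all the $g_{i,j}$. Then: 1. $\mathcal{S}=\bigoplus_{d=0}^{N}\mathcal{S}^{(d)}$;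 2. $\mathcal{S}$ contains no nonzero vector of Schmidt rank $\le 3$; 3. the vectors $g_{i,j}$ form a basis of $\mathcal{S}$, and $\dim\mathcal{S}=(m-3)(n-3)$; 4. this dimension is maximal: every subspace of $\mathbb{C}^m\otimes\mathbb{C}^n$ that contains no nonzero vector of Schmidt rank $\le 3$ has dimension at most $(m-3)(n-3)$; 5. each $g_{i,j}$ has Schmidt rank exactly $4$. -/

import Mathlib

open scoped TensorProduct

noncomputable section

namespace SchmidtSubspace

/-- The bipartite space `ℂ^m ⊗ ℂ^n`, each factor carrying its standard inner product. -/
abbrev Bipartite (m n : ℕ) : Type :=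
  EuclideanSpace ℂ (Fin m) ⊗[ℂ] EuclideanSpace ℂ (Fin n)

/-- `ψ` has a Schmidt decomposition with exactly `k` terms: `ψ = ∑ j, α j • (u j ⊗ v j)` with
`u`, `v` orthonormal and every `α j` positive. (For a unit vector `ψ` the `α j` then
automatically satisfy `∑ j, α j ^ 2 = 1`; the zero vector has the empty decomposition.) -/
def HasSchmidtDecomposition {m n : ℕ} (ψ : Bipartite m n) (k : ℕ) : Prop :=
  ∃ (α : Fin k → ℝ) (u : Fin k → EuclideanSpace ℂ (Fin m)) (v : Fin k → EuclideanSpace ℂ (Fin n)),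
    (∀ j, 0 < α j) ∧ Orthonormal ℂ u ∧ Orthonormal ℂ v ∧
      ψ = ∑ j, (α j : ℂ) • (u j ⊗ₜ[ℂ] v j)

/-- The Schmidt rank: the minimum number of terms in a Schmidt decomposition. The set below is
never empty, by the Schmidt decomposition theorem. -/
def schmidtRank {m n : ℕ} (ψ : Bipartite m n) : ℕ :=
  sInf {k | HasSchmidtDecomposition ψ k}

/-- The canonical basis vector of `ℂ^m` with index `k`, where `0 ≤ k ≤ m - 1`.
(The value is `0` for `k ≥ m`, which is never used.) -/
def ket (m k : ℕ) : EuclideanSpace ℂ (Fin m) :=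
  if h : k < m then EuclideanSpace.single ⟨k, h⟩ 1 else 0

/-- The vector `e_{i-2} ⊗ f_{j+1} - a e_{i-1} ⊗ f_j + a e_i ⊗ f_{j-1} - e_{i+1} ⊗ f_{j-2}`,
used for `(i, j)` in `indexSet m n` only. -/
def gen (m n : ℕ) (a : ℝ) (p : ℕ × ℕ) : Bipartite m n :=
  ket m (p.1 - 2) ⊗ₜ[ℂ] ket n (p.2 + 1)
    - (a : ℂ) • (ket m (p.1 - 1) ⊗ₜ[ℂ] ket n p.2)
    + (a : ℂ) • (ket m p.1 ⊗ₜ[ℂ] ket n (p.2 - 1))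
    - ket m (p.1 + 1) ⊗ₜ[ℂ] ket n (p.2 - 2)

/-- The pairs `(i, j)` with `2 ≤ i ≤ m - 2` and `2 ≤ j ≤ n - 2`. -/
def indexSet (m n : ℕ) : Set (ℕ × ℕ) :=
  {p | 2 ≤ p.1 ∧ p.1 + 2 ≤ m ∧ 2 ≤ p.2 ∧ p.2 + 2 ≤ n}

/-- `S^(d)`: the span of the generators with `i + j = d + 1`. There are none for `d < 3` and for
`d > m + n - 5`, so that `S^(d) = 0` then. -/
def component (m n : ℕ) (a : ℝ) (d : ℕ) : Submodule ℂ (Bipartite m n) :=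
  Submodule.span ℂ (gen m n a '' {p ∈ indexSet m n | p.1 + p.2 = d + 1})

/-- `S`: the span of all the generators. -/
def subspaceS (m n : ℕ) (a : ℝ) : Submodule ℂ (Bipartite m n) :=
  Submodule.span ℂ (gen m n a '' indexSet m n)

end SchmidtSubspace

end

open scoped TensorProduct

noncomputable section

namespace SchmidtSubspace

/-! The Schmidt rank of a vector is the rank of its coefficient matrix (`schmidtRank_eq_rank`), so
the theorem concerns linear spaces of matrices.

Lower bound (`three_lt_rank_sum_gen`): each generator lives on one antidiagonal, where it reads `X ^
(i - 2)` times `1 - aX + aX² - X³`. For `a ≥ 3` this cubic has three positive roots, so by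
Descartes' rule of signs every nonzero multiple has at least four nonzero coefficients. In a
nontrivial combination of generators, the lowest antidiagonal that occurs thus has four nonzero
entries and only zeros before it; a triangular minor gives rank at least 4. Linear independence, the
direct sum and the dimension follow.

Upper bound (`finrank_le_of_forall_rank_le`): matrices of rank at most `r` form a cone of
codimension at least... `(m - r)(n - r)` is its codimension, and a linear space meeting it only in 0
cannot have larger dimension. The dimension theorem is proved by the Nullstellensatz and integrality
(`trdeg_add_finrank_le`), and the dimension of the cone is bounded below by algebraically
independent entries (`algebraicIndependent_border`). -/

/-! ### Schmidt rank as matrix rank -/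

/-- The coefficient matrix of a bipartite vector with respect to the canonical bases. -/
def coeffMatrix (m n : ℕ) : Bipartite m n ≃ₗ[ℂ] Matrix (Fin m) (Fin n) ℂ :=
  ((EuclideanSpace.basisFun (Fin m) ℂ).toBasis.tensorProduct
    (EuclideanSpace.basisFun (Fin n) ℂ).toBasis).equivFun ≪≫ₗ
    LinearEquiv.curry ℂ ℂ (Fin m) (Fin n)

lemma coeffMatrix_tmul {m n : ℕ} (u : EuclideanSpace ℂ (Fin m)) (v : EuclideanSpace ℂ (Fin n)) :
    coeffMatrix m n (u ⊗ₜ[ℂ] v) = Matrix.vecMulVec u v := by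
  ext i j
  change ((EuclideanSpace.basisFun (Fin m) ℂ).toBasis.tensorProduct
    (EuclideanSpace.basisFun (Fin n) ℂ).toBasis).repr (u ⊗ₜ[ℂ] v) (i, j) = _
  rw [Module.Basis.tensorProduct_repr_tmul_apply]
  simp [Matrix.vecMulVec_apply, mul_comm]

lemma rank_coeffMatrix_sum_tmul_le {m n k : ℕ} (u : Fin k → EuclideanSpace ℂ (Fin m))
    (v : Fin k → EuclideanSpace ℂ (Fin n)) :
    (coeffMatrix m n (∑ j, u j ⊗ₜ[ℂ] v j)).rank ≤ k := by
  have : coeffMatrix m n (∑ j, u j ⊗ₜ[ℂ] v j) =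
      (Matrix.of fun i j => u j i) * (Matrix.of fun j i => v j i) := by
    ext i l
    simp only [map_sum, coeffMatrix_tmul, Matrix.mul_apply, Matrix.sum_apply,
      Matrix.vecMulVec_apply, Matrix.of_apply]
  rw [this]
  exact (Matrix.rank_mul_le_left _ _).trans (Matrix.rank_le_width _)

lemma HasSchmidtDecomposition.rank_le {m n k : ℕ} {ψ : Bipartite m n}
    (h : HasSchmidtDecomposition ψ k) : (coeffMatrix m n ψ).rank ≤ k := by
  obtain ⟨α, u, v, -, -, -, rfl⟩ := h
  simp only [TensorProduct.smul_tmul']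
  exact rank_coeffMatrix_sum_tmul_le _ _

-- This is the singular value decomposition. For an orthonormal eigenbasis `b` of `Aᴴ * A`, the
-- vectors `A b_k` are pairwise orthogonal with squared norms the eigenvalues, and the nonzero ones,
-- normalised, give the left family.
open scoped ComplexOrder in
lemma hasSchmidtDecomposition_rank {m n : ℕ} (ψ : Bipartite m n) :
    HasSchmidtDecomposition ψ (coeffMatrix m n ψ).rank := by
  set A := coeffMatrix m n ψ with hAdef
  have hA := Matrix.isHermitian_conjTranspose_mul_self A
  have hpos := (Matrix.posSemidef_conjTranspose_mul_self A).eigenvalues_nonneg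
  set b := hA.eigenvectorBasis with hb
  set l := hA.eigenvalues with hl
  have hcard : Fintype.card {i // l i ≠ 0} = A.rank := by
    rw [← hA.rank_eq_card_non_zero_eigs, Matrix.rank_conjTranspose_mul_self]
  let e : Fin A.rank ≃ {i // l i ≠ 0} := (Fintype.equivFinOfCardEq hcard).symm
  have hl0 : ∀ i, 0 < l (e i) := fun i => lt_of_le_of_ne (hpos _) (e i).2.symm
  have hdot : ∀ i j, star (A.mulVec (b i)) ⬝ᵥ (A.mulVec (b j)) =
      if i = j then (l j : ℂ) else 0 := by
    intro i j
    have h1 : (A.conjTranspose * A).mulVec (b j) = l j • (b j : Fin n → ℂ) :=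
      hA.mulVec_eigenvectorBasis j
    rw [Matrix.star_mulVec, ← Matrix.dotProduct_mulVec, Matrix.mulVec_mulVec, h1]
    have h2 := orthonormal_iff_ite.mp b.orthonormal i j
    rw [EuclideanSpace.inner_eq_star_dotProduct, dotProduct_comm] at h2
    rw [dotProduct_smul, h2]
    split_ifs <;> simp
  have hsum : ∀ i j, A i j = ∑ k, (A.mulVec (b k)) i * star (b k j) := by
    intro i j
    have h1 := b.sum_repr' (EuclideanSpace.single j (1 : ℂ))
    have h2 := congrArg (fun w : EuclideanSpace ℂ (Fin n) => (A.mulVec w) i) h1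
    simp only [WithLp.ofLp_sum, WithLp.ofLp_smul, Matrix.mulVec_sum, Matrix.mulVec_smul,
      Finset.sum_apply, Pi.smul_apply] at h2
    simp at h2
    rw [← h2]
    exact Finset.sum_congr rfl fun k _ => by
      simp [EuclideanSpace.inner_single_right, mul_comm]
  have hzero : ∀ k, l k = 0 → A.mulVec (b k) = 0 := by
    intro k hk
    have := hdot k k
    rw [if_pos rfl, hk, Complex.ofReal_zero] at this
    rwa [dotProduct_comm, dotProduct_self_star_eq_zero] at this
  -- The right vectors are conjugated because `hsum` expands `A` with the entries of `star (b k)`,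
  -- while the tensor product is bilinear.
  refine ⟨fun j => √(l (e j)),
    fun j => WithLp.toLp 2 (((√(l (e j)) : ℝ) : ℂ)⁻¹ • A.mulVec (b (e j))),
    fun j => WithLp.toLp 2 (star (b (e j) : Fin n → ℂ)), fun j => Real.sqrt_pos.2 (hl0 j),
    ?_, ?_, ?_⟩
  · rw [orthonormal_iff_ite]
    intro i j
    rw [EuclideanSpace.inner_eq_star_dotProduct, dotProduct_comm]
    simp only [star_smul, smul_dotProduct, dotProduct_smul, hdot]
    by_cases hij : i = j
    · subst hij
      have h0 : ((√(l (e i)) : ℝ) : ℂ) ≠ 0 := by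
        exact_mod_cast (Real.sqrt_pos.2 (hl0 i)).ne'
      have h1 : ((l (e i) : ℝ) : ℂ) = ((√(l (e i)) : ℝ) : ℂ) * ((√(l (e i)) : ℝ) : ℂ) := by
        exact_mod_cast (Real.mul_self_sqrt (hl0 i).le).symm
      simp [h1]
      field_simp
    · have : (e i : Fin n) ≠ e j := fun h => hij (e.injective (Subtype.ext h))
      simp [hij, this]
  · rw [orthonormal_iff_ite]
    intro i j
    have h2 := orthonormal_iff_ite.mp b.orthonormal (e j) (e i)
    rw [EuclideanSpace.inner_eq_star_dotProduct] at h2 ⊢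
    simp only [star_star]
    rw [dotProduct_comm, h2]
    simp [Subtype.val_inj, eq_comm]
  · apply (coeffMatrix m n).injective
    rw [← hAdef]
    ext i j
    rw [hsum]
    simp only [map_sum, map_smul, coeffMatrix_tmul, Matrix.sum_apply, Matrix.smul_apply,
      Matrix.vecMulVec_apply, smul_eq_mul, Pi.smul_apply, Pi.star_apply]
    trans ∑ k : {k // l k ≠ 0}, A.mulVec (b k) i * star (b k j)
    · rw [← Finset.sum_subtype (Finset.univ.filter (l · ≠ 0)) (by simp)
        (fun k => A.mulVec (b k) i * star (b k j))]
      symm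
      apply Finset.sum_filter_of_ne
      intro k _ hk h0
      exact hk (by simp [hzero k h0])
    rw [← e.sum_comp]
    refine Finset.sum_congr rfl fun k _ => ?_
    have h0 : ((√(l (e k)) : ℝ) : ℂ) ≠ 0 := by
      exact_mod_cast (Real.sqrt_pos.2 (hl0 k)).ne'
    field_simp

lemma schmidtRank_eq_rank {m n : ℕ} (ψ : Bipartite m n) :
    schmidtRank ψ = (coeffMatrix m n ψ).rank :=
  le_antisymm (Nat.sInf_le (hasSchmidtDecomposition_rank ψ))
    (le_csInf ⟨_, hasSchmidtDecomposition_rank ψ⟩ fun _ h => h.rank_le)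

/-! ### Descartes' rule of signs for multiples of the cubic -/

section Descartes

open Polynomial

/-- Erasing the leading term shrinks the support and loses at most one sign variation. -/
lemma signVariations_lt_card_support {R : Type*} [Ring R] [LinearOrder R] {P : R[X]} (hP : P ≠ 0) :
    P.signVariations < P.support.card := by
  induction h : P.support.card using Nat.strong_induction_on generalizing P with
  | _ k ih =>
    subst h
    by_cases h0 : P.eraseLead = 0
    · have : 0 < P.support.card := Finset.card_pos.2 (nonempty_support_iff.2 hP)
      rw [signVariations_eq_eraseLead_add_ite hP, h0]
      simp [hP]
    · have h1 := eraseLead_support_card_lt hP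
      have h2 := ih _ h1 h0 rfl
      have h3 := P.signVariations_le_eraseLead_succ
      omega

/-- The antipalindromic cubic whose shifts are the generators. -/
def cubic {R : Type*} [CommRing R] (a : R) : R[X] := 1 - C a * X + C a * X ^ 2 - X ^ 3

/-- Besides the root 1 there remains `X² - (a - 1)X + 1`, whose discriminant is nonnegative for `a ≥
3`; its roots have product 1 and positive sum. They may coincide, since Descartes' rule counts
multiplicity. -/
lemma exists_cubic_eq {a : ℝ} (ha : 3 ≤ a) : ∃ r s : ℝ, 0 < r ∧ 0 < s ∧
    cubic a = -((X - C 1) * ((X - C r) * (X - C s))) := by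
  have hD : 0 ≤ (a - 1) ^ 2 - 4 := by nlinarith
  have hsq := Real.sq_sqrt hD
  have hlt : √((a - 1) ^ 2 - 4) < a - 1 := by
    rw [Real.sqrt_lt' (by linarith)]; linarith
  refine ⟨((a - 1) + √((a - 1) ^ 2 - 4)) / 2, ((a - 1) - √((a - 1) ^ 2 - 4)) / 2, ?_, ?_, ?_⟩
  · have := Real.sqrt_nonneg ((a - 1) ^ 2 - 4)
    linarith
  · linarith
  set t := √((a - 1) ^ 2 - 4) with ht
  have h1 : C ((a - 1 + t) / 2) + C ((a - 1 - t) / 2) = C a - 1 := by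
    rw [← C_add, ← C_1, ← C_sub]; congr 1; ring
  have h2 : C ((a - 1 + t) / 2) * C ((a - 1 - t) / 2) = (1 : ℝ[X]) := by
    rw [← C_mul, ← C_1]; congr 1; nlinarith
  rw [cubic, C_1]
  linear_combination (-X ^ 2 + X) * h1 + (X - 1) * h2

/-- Each factor `X - C t` with `t > 0` adds at least one sign variation. -/
lemma three_lt_card_support_mul_cubic_real {a : ℝ} (ha : 3 ≤ a) {P : ℝ[X]} (hP : P ≠ 0) :
    3 < (P * cubic a).support.card := by
  obtain ⟨r, s, hr, hs, h⟩ := exists_cubic_eq ha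
  have hX : ∀ t : ℝ, X - C t ≠ 0 := fun t => X_sub_C_ne_zero t
  have h0 : (X - C s) * P ≠ 0 := mul_ne_zero (hX _) hP
  have h1 : (X - C r) * ((X - C s) * P) ≠ 0 := mul_ne_zero (hX _) h0
  have h2 : (X - C 1) * ((X - C r) * ((X - C s) * P)) ≠ 0 := mul_ne_zero (hX _) h1
  have k0 := succ_signVariations_le_X_sub_C_mul hs hP
  have k1 := succ_signVariations_le_X_sub_C_mul hr h0
  have k2 := succ_signVariations_le_X_sub_C_mul one_pos h1
  have k3 := signVariations_lt_card_support h2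
  have e : P * cubic a = -((X - C 1) * ((X - C r) * ((X - C s) * P))) := by rw [h]; ring
  rw [e, support_neg]
  omega

/-- A nonzero multiple of the cubic has at least four nonzero coefficients. -/
lemma three_lt_card_support_mul_cubic {a : ℝ} (ha : 3 ≤ a) {P : ℂ[X]} (hP : P ≠ 0) :
    3 < (P * cubic (a : ℂ)).support.card := by
  -- The cubic has real coefficients, so applying `φ` (real or imaginary part) to coefficients
  -- commutes with multiplication by it and can only shrink the support.
  have key : ∀ φ : ℂ →ₗ[ℝ] ℝ, (∃ i, φ (P.coeff i) ≠ 0) →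
      3 < (P * cubic (a : ℂ)).support.card := by
    rintro φ ⟨i, hi⟩
    let Q : ℝ[X] := ∑ k ∈ P.support, monomial k (φ (P.coeff k))
    have hQ : ∀ k, Q.coeff k = φ (P.coeff k) := by
      intro k
      simp only [Q, finsetSum_coeff, coeff_monomial]
      by_cases hk : k ∈ P.support
      · simp [hk]
      · simp [notMem_support_iff.1 hk]
    have hQ0 : Q ≠ 0 := fun h => hi (by rw [← hQ, h, coeff_zero])
    refine (three_lt_card_support_mul_cubic_real ha hQ0).trans_le (Finset.card_le_card ?_)
    intro k hk
    rw [mem_support_iff] at hk ⊢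
    contrapose! hk
    have hc : ∀ (R : Type) [CommRing R] (F : R[X]) (b : R), (F * cubic b).coeff k =
        F.coeff k - b * (if 1 ≤ k then F.coeff (k - 1) else 0) +
          b * (if 2 ≤ k then F.coeff (k - 2) else 0) - (if 3 ≤ k then F.coeff (k - 3) else 0) := by
      intro R _ F b
      have : F * cubic b = F - C b * (F * X ^ 1) + C b * (F * X ^ 2) - F * X ^ 3 := by
        rw [cubic]; ring
      rw [this]
      simp only [coeff_sub, coeff_add, coeff_C_mul, coeff_mul_X_pow']
    rw [hc] at hk ⊢
    have := congrArg φ hk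
    have hs : ∀ z : ℂ, φ ((a : ℂ) * z) = a * φ z := fun z => by
      rw [← Complex.real_smul, map_smul, smul_eq_mul]
    simp only [map_sub, map_add, hs, map_zero, apply_ite φ] at this
    simpa only [hQ] using this
  obtain ⟨i, hi⟩ : ∃ i, P.coeff i ≠ 0 := by
    by_contra! h
    exact hP (ext (by simpa using h))
  by_cases hre : (P.coeff i).re = 0
  · exact key Complex.imLm ⟨i, fun him => hi (Complex.ext hre him)⟩
  · exact key Complex.reLm ⟨i, hre⟩

end Descartes

/-! ### Rank bounds from the lowest antidiagonal -/

section Antidiagonal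

open Polynomial

/-- Pair each row `i` of `s` with column `d - i`. For `i < j` the entry in row `i` and column `d -
j` lies below antidiagonal `d`, so this square submatrix is triangular with nonzero diagonal. -/
lemma card_le_rank_of_antidiagonal {K : Type*} [Field K] {m n : ℕ} (M : Matrix (Fin m) (Fin n) K)
    (d : ℕ) (hlow : ∀ (i : Fin m) (j : Fin n), (i : ℕ) + j < d → M i j = 0) (s : Finset (Fin m))
    (hs : ∀ i ∈ s, ∃ j : Fin n, (i : ℕ) + j = d ∧ M i j ≠ 0) : s.card ≤ M.rank := by
  choose g hg hM using hs
  let N : Matrix s s K := M.submatrix Subtype.val fun i => g i i.2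
  have hN : N.det ≠ 0 := by
    rw [Matrix.det_of_isLowerTriangular]
    · exact Finset.prod_ne_zero_iff.2 fun i _ => hM i i.2
    · intro i j hij
      have hij : i < j := hij
      have h1 := hg j j.2
      have h2 : ((i : Fin m) : ℕ) < (j : Fin m) := hij
      exact hlow _ _ (by dsimp only; omega)
  have h1 : N.rank = s.card := by
    rw [Matrix.rank_of_isUnit _ ((Matrix.isUnit_iff_isUnit_det _).2 hN.isUnit)]
    simp
  rw [← h1]
  exact Matrix.rank_submatrix_le _ _ _

/-- The generating polynomial of the antidiagonal `i + j = d` of the coefficient matrix. -/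
def antidiag (m n d : ℕ) : Bipartite m n →ₗ[ℂ] ℂ[X] where
  toFun ψ := ∑ i : Fin m, ∑ j : Fin n,
    coeffMatrix m n ψ i j • (if (i : ℕ) + j = d then (X : ℂ[X]) ^ (i : ℕ) else 0)
  map_add' ψ φ := by
    simp only [map_add, Matrix.add_apply, add_smul, Finset.sum_add_distrib]
  map_smul' c ψ := by simp [mul_smul, Finset.smul_sum]

lemma antidiag_apply {m n : ℕ} (d : ℕ) (ψ : Bipartite m n) :
    antidiag m n d ψ = ∑ i : Fin m, ∑ j : Fin n,
      coeffMatrix m n ψ i j • (if (i : ℕ) + j = d then (X : ℂ[X]) ^ (i : ℕ) else 0) := rfl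

lemma coeff_antidiag {m n d : ℕ} (ψ : Bipartite m n) (i : Fin m) (j : Fin n)
    (h : (i : ℕ) + j = d) : (antidiag m n d ψ).coeff i = coeffMatrix m n ψ i j := by
  rw [antidiag_apply, finsetSum_coeff, Finset.sum_eq_single i, finsetSum_coeff,
    Finset.sum_eq_single j]
  · simp [h]
  · intro j' _ hj
    have : (i : ℕ) + j' ≠ d := fun h' => hj (Fin.ext (by omega))
    simp [this]
  · simp
  · intro i' _ hi
    rw [finsetSum_coeff]
    refine Finset.sum_eq_zero fun j' _ => ?_
    have : (i : ℕ) ≠ i' := fun h' => hi (Fin.ext h'.symm)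
    split_ifs <;> simp [coeff_X_pow, this]
  · simp

lemma exists_of_coeff_antidiag_ne_zero {m n d r : ℕ} {ψ : Bipartite m n}
    (h : (antidiag m n d ψ).coeff r ≠ 0) : ∃ (i : Fin m) (j : Fin n), (i : ℕ) = r ∧
      (i : ℕ) + j = d ∧ coeffMatrix m n ψ i j ≠ 0 := by
  have h' := h
  rw [antidiag_apply, finsetSum_coeff] at h'
  obtain ⟨i, -, hi⟩ := Finset.exists_ne_zero_of_sum_ne_zero h'
  rw [finsetSum_coeff] at hi
  obtain ⟨j, -, hj⟩ := Finset.exists_ne_zero_of_sum_ne_zero hi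
  by_cases hd : (i : ℕ) + j = d
  · by_cases hr : r = i
    · subst hr
      exact ⟨i, j, rfl, hd, by rwa [← coeff_antidiag ψ i j hd]⟩
    · simp [hd, coeff_X_pow, hr] at hj
  · simp [hd] at hj

lemma antidiag_ket_tmul_ket {m n r s : ℕ} (d : ℕ) (hr : r < m) (hs : s < n) :
    antidiag m n d (ket m r ⊗ₜ[ℂ] ket n s) = if r + s = d then X ^ r else 0 := by
  rw [antidiag_apply, Finset.sum_eq_single ⟨r, hr⟩, Finset.sum_eq_single ⟨s, hs⟩]
  · simp [coeffMatrix_tmul, Matrix.vecMulVec_apply, ket, hr, hs]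
  · intro j _ hj
    simp [coeffMatrix_tmul, Matrix.vecMulVec_apply, ket, hr, hs, hj]
  · simp
  · intro i _ hi
    simp [coeffMatrix_tmul, Matrix.vecMulVec_apply, ket, hr, hs, hi]
  · simp

lemma antidiag_gen {m n : ℕ} (a : ℝ) (d : ℕ) {p : ℕ × ℕ} (hp : p ∈ indexSet m n) :
    antidiag m n d (gen m n a p) =
      (if p.1 + p.2 = d + 1 then X ^ (p.1 - 2) else 0) * cubic (a : ℂ) := by
  obtain ⟨i, j⟩ := p
  obtain ⟨h1, h2, h3, h4⟩ := hp
  simp only at h1 h2 h3 h4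
  -- Writing both indices as `k + 2` and `l + 2` makes the truncated subtractions in `gen` exact.
  obtain ⟨k, rfl⟩ := Nat.exists_eq_add_of_le' h1
  obtain ⟨l, rfl⟩ := Nat.exists_eq_add_of_le' h3
  simp only [gen, map_sub, map_add, map_smul]
  rw [antidiag_ket_tmul_ket d (by omega) (by omega), antidiag_ket_tmul_ket d (by omega) (by omega),
    antidiag_ket_tmul_ket d (by omega) (by omega), antidiag_ket_tmul_ket d (by omega) (by omega)]
  by_cases h : k + 2 + (l + 2) = d + 1
  · rw [if_pos (by omega), if_pos (by omega), if_pos (by omega), if_pos (by omega),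
      if_pos (by omega), cubic, smul_eq_C_mul, smul_eq_C_mul]
    simp only [Nat.add_sub_cancel, show k + 2 - 1 = k + 1 by omega]
    ring
  · rw [if_neg (by omega), if_neg (by omega), if_neg (by omega), if_neg (by omega),
      if_neg (by omega)]
    simp

/-- A nontrivial combination of the generators has a coefficient matrix of rank at least four. -/
lemma three_lt_rank_sum_gen {m n : ℕ} {a : ℝ} (ha : 3 ≤ a) (F : Finset (ℕ × ℕ))
    (hF : ∀ p ∈ F, p ∈ indexSet m n) (c : ℕ × ℕ → ℂ) (hc : ∃ p ∈ F, c p ≠ 0) :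
    3 < (coeffMatrix m n (∑ p ∈ F, c p • gen m n a p)).rank := by
  set ψ := ∑ p ∈ F, c p • gen m n a p with hψ
  -- `q` lies on the lowest antidiagonal that carries a nonzero coefficient.
  obtain ⟨q, hq, hmin⟩ := Finset.exists_min_image (F.filter (c · ≠ 0)) (fun p => p.1 + p.2)
    (by obtain ⟨p, hp, hp'⟩ := hc; exact ⟨p, by simp [hp, hp']⟩)
  rw [Finset.mem_filter] at hq
  obtain ⟨hq1, -, hq2, -⟩ := hF q hq.1
  have hanti : ∀ d, antidiag m n d ψ =
      (∑ p ∈ F, C (c p) * (if p.1 + p.2 = d + 1 then X ^ (p.1 - 2) else 0)) * cubic (a : ℂ) := by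
    intro d
    rw [hψ, map_sum, Finset.sum_mul]
    refine Finset.sum_congr rfl fun p hp => ?_
    rw [map_smul, antidiag_gen a d (hF p hp), smul_eq_C_mul, mul_assoc]
  obtain ⟨d, hd⟩ : ∃ d, q.1 + q.2 = d + 1 := ⟨q.1 + q.2 - 1, by omega⟩
  have hlow : ∀ (i : Fin m) (j : Fin n), (i : ℕ) + j < d → coeffMatrix m n ψ i j = 0 := by
    intro i j hij
    rw [← coeff_antidiag ψ i j rfl, hanti, Finset.sum_eq_zero, zero_mul, coeff_zero]
    intro p hp
    by_cases hcp : c p = 0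
    · simp [hcp]
    · have := hmin p (by simp [hp, hcp])
      rw [if_neg (by omega), mul_zero]
  -- On one antidiagonal distinct generators have distinct `p.1`, so their monomials cannot cancel.
  have hne : (∑ p ∈ F, C (c p) * (if p.1 + p.2 = d + 1 then X ^ (p.1 - 2) else 0) : ℂ[X]) ≠ 0 := by
    intro h0
    have h1 := congrArg (fun P : ℂ[X] => P.coeff (q.1 - 2)) h0
    simp only [finsetSum_coeff, coeff_zero] at h1
    rw [Finset.sum_eq_single q] at h1
    · exact hq.2 (by simpa [hd] using h1)
    · intro p hp hpq
      rw [coeff_C_mul]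
      split_ifs with hpd
      · obtain ⟨hp1, -, hp2, -⟩ := hF p hp
        have : q.1 - 2 ≠ p.1 - 2 := fun h => hpq (Prod.ext (by omega) (by omega))
        simp [coeff_X_pow, this]
      · simp
    · exact fun h => absurd hq.1 h
  have hcard := three_lt_card_support_mul_cubic ha hne
  rw [← hanti] at hcard
  refine hcard.trans_le ?_
  let s : Finset (Fin m) := Finset.univ.filter fun i => (i : ℕ) ∈ (antidiag m n d ψ).support
  have hs : (antidiag m n d ψ).support = s.map Fin.valEmbedding := by
    ext r
    simp only [Finset.mem_map, s, Finset.mem_filter, Finset.mem_univ, true_and,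
      Fin.valEmbedding_apply]
    refine ⟨fun hr => ?_, fun ⟨i, hi, hir⟩ => hir ▸ hi⟩
    obtain ⟨i, -, rfl, -⟩ := exists_of_coeff_antidiag_ne_zero (mem_support_iff.1 hr)
    exact ⟨i, hr, rfl⟩
  rw [hs, Finset.card_map]
  refine card_le_rank_of_antidiagonal _ d hlow s fun i hi => ?_
  obtain ⟨i', j, hi', hj⟩ :=
    exists_of_coeff_antidiag_ne_zero (mem_support_iff.1 (Finset.mem_filter.1 hi).2)
  obtain rfl : i' = i := Fin.ext hi'
  exact ⟨j, hj⟩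

end Antidiagonal

/-! ### A dimension theorem for cones and linear subspaces -/

section Graded

open MvPolynomial

variable {σ K : Type*} [Field K]

attribute [local instance] MvPolynomial.gradedAlgebra

lemma homogeneousComponent_succ_mul_of_isHomogeneous_one {l : MvPolynomial σ K}
    (hl : l.IsHomogeneous 1) (g : MvPolynomial σ K) (d : ℕ) :
    homogeneousComponent (d + 1) (l * g) = l * homogeneousComponent d g := by
  conv_lhs => rw [← sum_homogeneousComponent g, Finset.mul_sum, map_sum]
  have h : ∀ i, homogeneousComponent (d + 1) (l * homogeneousComponent i g) =
      if i = d then l * homogeneousComponent d g else 0 := by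
    intro i
    have := hl.mul (homogeneousComponent_isHomogeneous i g)
    rw [homogeneousComponent_of_mem this]
    split_ifs with h1 h2 h2
    · rw [h2]
    · omega
    · omega
    · rfl
  simp only [h, Finset.sum_ite_eq', Finset.mem_range]
  split_ifs with h1
  · rfl
  · rw [homogeneousComponent_eq_zero _ _ (by omega), mul_zero]

/-- If a homogeneous polynomial of positive degree lies in the sum of a homogeneous ideal and an
ideal generated by linear forms, then the coefficients of the linear forms can be chosen
homogeneous of degree one less. -/
lemma exists_homogeneous_coeffs {ι : Type*} [Fintype ι] {I : Ideal (MvPolynomial σ K)}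
    (hI : I.IsHomogeneous (homogeneousSubmodule σ K)) {l : ι → MvPolynomial σ K}
    (hl : ∀ s, (l s).IsHomogeneous 1) {g : MvPolynomial σ K} {d : ℕ}
    (hg : g.IsHomogeneous (d + 1)) (hmem : g ∈ I ⊔ Ideal.span (Set.range l)) :
    ∃ b : ι → MvPolynomial σ K, (∀ s, (b s).IsHomogeneous d) ∧ g - ∑ s, l s * b s ∈ I := by
  obtain ⟨y, hy, z, hz, rfl⟩ := Submodule.mem_sup.1 hmem
  obtain ⟨c, rfl⟩ := (Ideal.mem_span_range_iff_exists_fun).1 hz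
  -- Take degree `d + 1` parts of the whole identity; the part of `y` stays in `I` because `I` is
  -- homogeneous.
  refine ⟨fun s => homogeneousComponent d (c s), fun s => homogeneousComponent_isHomogeneous _ _, ?_⟩
  have h1 := homogeneousComponent_mem_of_mem hI hy (d + 1)
  have h2 : homogeneousComponent (d + 1) (∑ s, c s * l s) =
      ∑ s, l s * homogeneousComponent d (c s) := by
    rw [map_sum]
    exact Finset.sum_congr rfl fun s _ => by
      rw [mul_comm, homogeneousComponent_succ_mul_of_isHomogeneous_one (hl s)]
  have h3 := homogeneousComponent_eq_self hg
  rw [map_add, h2] at h3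
  rw [← h3, add_sub_cancel_right]
  exact h1

/-- If linear forms and a homogeneous ideal `I` in the kernel of `f` have no common zero besides
the origin, then the image of `f` is integral over the subalgebra generated by the forms. -/
lemma isIntegral_adjoin_of_forall_zero [IsAlgClosed K] [Finite σ] {ι A : Type*} [Fintype ι]
    [CommRing A] [Algebra K A] (f : MvPolynomial σ K →ₐ[K] A) (hf : Function.Surjective f)
    {I : Ideal (MvPolynomial σ K)} (hI : I.IsHomogeneous (homogeneousSubmodule σ K))
    (hIf : I ≤ RingHom.ker f) {l : ι → MvPolynomial σ K} (hl : ∀ s, (l s).IsHomogeneous 1)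
    (hzero : ∀ x : σ → K, (∀ g ∈ I, eval x g = 0) → (∀ s, eval x (l s) = 0) → x = 0) :
    Algebra.IsIntegral (Algebra.adjoin K (Set.range fun s => f (l s))) A := by
  classical
  have := Fintype.ofFinite σ
  set J := I ⊔ Ideal.span (Set.range l) with hJ
  -- Nullstellensatz: `J` vanishes at most at the origin.
  have hrad : ∀ i, X i ∈ J.radical := by
    intro i
    rw [← vanishingIdeal_zeroLocus_eq_radical (K := K), mem_vanishingIdeal_iff]
    intro x hx
    rw [mem_zeroLocus_iff] at hx
    have : x = 0 := by
      refine hzero x (fun g hg => ?_) (fun s => ?_)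
      · simpa [aeval_eq_eval] using hx g (Ideal.mem_sup_left hg)
      · simpa [aeval_eq_eval] using hx (l s) (Ideal.mem_sup_right (Ideal.subset_span ⟨s, rfl⟩))
    simp [this]
  obtain ⟨N, hN⟩ : ∃ N, ∀ i, (X i : MvPolynomial σ K) ^ (N + 1) ∈ J := by
    choose k hk using hrad
    refine ⟨∑ i, k i, fun i => ?_⟩
    refine J.mem_of_dvd (pow_dvd_pow _ ?_) (hk i)
    have := Finset.single_le_sum (f := k) (fun _ _ => Nat.zero_le _) (Finset.mem_univ i)
    omega
  set B := Algebra.adjoin K (Set.range fun s => f (l s)) with hB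
  let M : Set (σ →₀ ℕ) := {e | ∀ i, e i ≤ N}
  have hMfin : M.Finite := by
    refine Set.Finite.of_finite_image (f := fun e : σ →₀ ℕ => (e : σ → ℕ))
      ((Set.finite_Iic fun _ : σ => N).subset ?_) DFunLike.coe_injective.injOn
    rintro _ ⟨e, he, rfl⟩
    exact he
  -- These finitely many monomials generate `A` over `B`. Any other monomial is divisible by some `X
  -- i ^ (N + 1)` in `J`, hence modulo `I` is a combination of the `l s` with coefficients of lower
  -- degree, and induction on degree applies.
  let V : Submodule B A := Submodule.span B ((fun e => f (monomial e 1)) '' M)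
  have key : ∀ d, ∀ g : MvPolynomial σ K, g.IsHomogeneous d → f g ∈ V := by
    have of_monomial : ∀ d, (∀ e : σ →₀ ℕ, e.degree = d → f (monomial e 1) ∈ V) →
        ∀ g : MvPolynomial σ K, g.IsHomogeneous d → f g ∈ V := by
      intro d h g hg
      rw [g.as_sum, map_sum]
      refine Submodule.sum_mem _ fun e he => ?_
      have hmon : monomial e (coeff e g) = coeff e g • monomial e (1 : K) := by
        simp [smul_monomial]
      rw [hmon, map_smul]
      refine V.smul_of_tower_mem _ (h e ?_)
      by_contra hne
      exact mem_support_iff.1 he (hg.coeff_eq_zero hne)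
    have of_mem : ∀ e ∈ M, f (monomial e 1) ∈ V := fun e he => Submodule.subset_span ⟨e, he, rfl⟩
    intro d
    induction d with
    | zero =>
      refine of_monomial 0 fun e he => of_mem e fun i => ?_
      rw [(Finsupp.degree_eq_zero_iff e).1 he]
      exact Nat.zero_le _
    | succ d ih =>
      refine of_monomial _ fun e he => ?_
      by_cases heM : e ∈ M
      · exact of_mem e heM
      obtain ⟨i, hi⟩ : ∃ i, N + 1 ≤ e i := by
        by_contra! h
        exact heM fun i => Nat.lt_succ_iff.1 (h i)
      have hJe : monomial e (1 : K) ∈ J := by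
        refine J.mem_of_dvd ?_ (hN i)
        rw [X_pow_eq_monomial]
        exact monomial_dvd_monomial.2 ⟨Or.inr (Finsupp.single_le_iff.2 hi), dvd_rfl⟩
      obtain ⟨b, hb, hmem⟩ := exists_homogeneous_coeffs hI hl (isHomogeneous_monomial 1 he) hJe
      have h0 : f (monomial e 1) = ∑ s, f (l s) * f (b s) := by
        have := hIf hmem
        rw [RingHom.mem_ker, map_sub, sub_eq_zero] at this
        rw [this, map_sum]
        simp
      rw [h0]
      refine Submodule.sum_mem _ fun s _ => ?_
      exact V.smul_mem (⟨f (l s), Algebra.subset_adjoin ⟨s, rfl⟩⟩ : B) (ih _ (hb s))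
  have htop : V = ⊤ := by
    refine eq_top_iff.2 fun y _ => ?_
    obtain ⟨g, rfl⟩ := hf y
    rw [← sum_homogeneousComponent g, map_sum]
    exact Submodule.sum_mem _ fun d _ => key d _ (homogeneousComponent_isHomogeneous d g)
  have : Module.Finite B A := ⟨⟨(hMfin.image _).toFinset, by simpa [V] using htop⟩⟩
  exact Algebra.IsIntegral.of_finite B A

/-- A linear subspace meeting the zero locus of a homogeneous ideal only in the origin has
codimension at least the dimension of that locus. -/
lemma trdeg_add_finrank_le [IsAlgClosed K] [Fintype σ] {A : Type*}
    [CommRing A] [IsDomain A] [Algebra K A] (f : MvPolynomial σ K →ₐ[K] A)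
    (hf : Function.Surjective f)
    {I : Ideal (MvPolynomial σ K)} (hI : I.IsHomogeneous (homogeneousSubmodule σ K))
    (hIf : I ≤ RingHom.ker f) (T : Submodule K (σ → K))
    (hT : ∀ x ∈ T, (∀ g ∈ I, eval x g = 0) → x = 0) :
    Algebra.trdeg K A + Module.finrank K T ≤ Fintype.card σ := by
  classical
  let b := Module.finBasis K ((σ → K) ⧸ T)
  let φ : Fin (Module.finrank K ((σ → K) ⧸ T)) → (σ → K) →ₗ[K] K := fun s => b.coord s ∘ₗ T.mkQ
  -- Coordinates on the quotient by `T`: codimension-many linear forms with common zero set `T`.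
  let l : Fin (Module.finrank K ((σ → K) ⧸ T)) → MvPolynomial σ K := fun s =>
    ∑ i, C (φ s (Pi.single i 1)) * X i
  have hl : ∀ s, (l s).IsHomogeneous 1 := fun s =>
    IsHomogeneous.sum _ _ _ fun i _ => by
      simpa using (isHomogeneous_C σ _).mul (isHomogeneous_X K i)
  have heval : ∀ x s, eval x (l s) = φ s x := by
    intro x s
    rw [LinearMap.pi_apply_eq_sum_univ (φ s) x]
    have h1 : ∀ i, (Pi.single i 1 : σ → K) = fun j => if i = j then 1 else 0 := fun i => by
      ext j
      simp [Pi.single_apply, eq_comm]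
    simp [l, h1, mul_comm]
  have hintegral := isIntegral_adjoin_of_forall_zero f hf hI hIf hl (fun x hx hx' => by
    refine hT x ?_ hx
    rw [← Submodule.Quotient.mk_eq_zero T, ← Submodule.mkQ_apply, ← b.forall_coord_eq_zero_iff]
    exact fun s => (heval x s).symm.trans (hx' s))
  have halg : Algebra.IsAlgebraic (Algebra.adjoin K (Set.range fun s => f (l s))) A :=
    Algebra.IsIntegral.isAlgebraic
  have h1 := Algebra.IsAlgebraic.trdeg_le_cardinalMk K (Set.range fun s => f (l s))
  have h2 : Cardinal.mk (Set.range fun s => f (l s)) ≤ Module.finrank K ((σ → K) ⧸ T) := by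
    simpa using Cardinal.mk_range_le_lift (f := fun s => f (l s))
  have h3 : Module.finrank K ((σ → K) ⧸ T) + Module.finrank K T = Fintype.card σ := by
    rw [Submodule.finrank_quotient_add_finrank, Module.finrank_fintype_fun_eq_card]
  rw [← h3]
  push_cast
  gcongr
  exact h1.trans h2

end Graded

/-! ### The determinantal variety and its dimension -/

section Determinantal

open MvPolynomial

universe u

lemma exists_rows_rank_eq {K m n : Type*} [Field K] [Fintype m] [Fintype n] (A : Matrix m n K)
    {k : ℕ} (hk : k ≤ A.rank) : ∃ g : Fin k → m, (A.submatrix g id).rank = k := by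
  rw [Matrix.rank_eq_finrank_span_row] at hk
  obtain ⟨f, hf, -, hli⟩ := Submodule.exists_fun_fin_finrank_span_eq K (Set.range A.row)
  choose g hg using hf
  refine ⟨fun i => g (Fin.castLE hk i), ?_⟩
  have hli' : LinearIndependent K (A.submatrix (fun i => g (Fin.castLE hk i)) id).row := by
    have h : (A.submatrix (fun i => g (Fin.castLE hk i)) id).row = f ∘ Fin.castLE hk :=
      funext fun i => hg _
    rw [h]
    exact hli.comp _ (Fin.castLE_injective hk)
  simpa using hli'.rank_matrix

lemma exists_minor_ne_zero {K m n : Type*} [Field K] [Fintype m] [Fintype n] (A : Matrix m n K)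
    {k : ℕ} (hk : k ≤ A.rank) :
    ∃ (g : Fin k → m) (h : Fin k → n), (A.submatrix g h).det ≠ 0 := by
  obtain ⟨g, hg⟩ := exists_rows_rank_eq A hk
  obtain ⟨h, hh⟩ := exists_rows_rank_eq (A.submatrix g id).transpose
    (by rw [Matrix.rank_transpose, hg])
  refine ⟨g, h, ?_⟩
  have hrank : (A.submatrix g h).rank = k := by
    rw [← Matrix.rank_transpose]
    exact hh
  have hli : LinearIndependent K (A.submatrix g h).row := by
    rw [linearIndependent_iff_card_eq_finrank_span, Set.finrank,
      ← Matrix.rank_eq_finrank_span_row, hrank, Fintype.card_fin]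
  exact ((Matrix.isUnit_iff_isUnit_det _).1
    (Matrix.linearIndependent_rows_iff_isUnit.1 hli)).ne_zero

variable (K : Type u) [Field K] (r : ℕ) (α β : Type u)

/-- The generic product of a matrix with `r` columns and a matrix with `r` rows, as a map from the
coordinate ring of the space of matrices. -/
def genericProduct : MvPolynomial ((Fin r ⊕ α) × (Fin r ⊕ β)) K →ₐ[K]
    MvPolynomial (((Fin r ⊕ α) × Fin r) ⊕ (Fin r × (Fin r ⊕ β))) K :=
  aeval fun p => ∑ k, X (Sum.inl (p.1, k)) * X (Sum.inr (k, p.2))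

/-- The minor of the generic matrix with the given rows and columns. -/
def genericMinor (p : (Fin (r + 1) → Fin r ⊕ α) × (Fin (r + 1) → Fin r ⊕ β)) :
    MvPolynomial ((Fin r ⊕ α) × (Fin r ⊕ β)) K :=
  (Matrix.of fun i j => X (p.1 i, p.2 j)).det

lemma isHomogeneous_genericMinor (p) : (genericMinor K r α β p).IsHomogeneous (r + 1) := by
  rw [genericMinor, Matrix.det_apply]
  refine IsHomogeneous.sum _ _ _ fun τ _ => ?_
  have h : (∏ i, (Matrix.of fun i j => (X (p.1 i, p.2 j) :
      MvPolynomial ((Fin r ⊕ α) × (Fin r ⊕ β)) K)) (τ i) i).IsHomogeneous (∑ i : Fin (r + 1), 1) :=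
    IsHomogeneous.prod _ _ _ fun i _ => isHomogeneous_X _ _
  rw [Finset.sum_const, Finset.card_univ, Fintype.card_fin, smul_eq_mul, mul_one] at h
  rw [Units.smul_def, ← Int.cast_smul_eq_zsmul K, smul_eq_C_mul]
  have h' := (isHomogeneous_C _ ((Equiv.Perm.sign τ : ℤ) : K)).mul h
  rwa [zero_add] at h'

/-- The minor becomes the determinant of an `(r + 1) × r` matrix times an `r × (r + 1)` matrix. -/
lemma genericProduct_genericMinor (p) : genericProduct K r α β (genericMinor K r α β p) = 0 := by
  rw [genericMinor, AlgHom.map_det]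
  by_contra h
  have h1 := Matrix.rank_of_det_ne_zero h
  let U : Matrix (Fin (r + 1)) (Fin r)
      (MvPolynomial (((Fin r ⊕ α) × Fin r) ⊕ (Fin r × (Fin r ⊕ β))) K) :=
    Matrix.of fun i k => X (Sum.inl (p.1 i, k))
  let W : Matrix (Fin r) (Fin (r + 1))
      (MvPolynomial (((Fin r ⊕ α) × Fin r) ⊕ (Fin r × (Fin r ⊕ β))) K) :=
    Matrix.of fun k j => X (Sum.inr (k, p.2 j))
  have h2 : (genericProduct K r α β).mapMatrix (Matrix.of fun i j => X (p.1 i, p.2 j)) =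
      U * W := by
    ext1 i j
    simp [genericProduct, Matrix.mul_apply, U, W]
  rw [h2, Fintype.card_fin] at h1
  have h3 := (Matrix.rank_mul_le_left U W).trans (Matrix.rank_le_card_width U)
  rw [h1, Fintype.card_fin] at h3
  omega

/-- The positions in the first `r` rows or the first `r` columns. -/
def borderIndex : (Fin r × (Fin r ⊕ β)) ⊕ (α × Fin r) → (Fin r ⊕ α) × (Fin r ⊕ β)
  | Sum.inl (i, j) => (Sum.inl i, j)
  | Sum.inr (i, j) => (Sum.inr i, Sum.inl j)

/-- A border with invertible corner `E` can be prescribed freely: it is completed by a product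
through `K ^ r`. A relation `q` thus vanishes wherever `det E ≠ 0`, so `q * D = 0`. This bounds the
transcendence degree of the range of `genericProduct` from below. -/
lemma algebraicIndependent_border [Fintype α] [Infinite K] :
    AlgebraicIndependent K fun s => (genericProduct K r α β).rangeRestrict
      (X (borderIndex r α β s)) := by
  rw [algebraicIndependent_iff]
  intro q hq
  have hq' : genericProduct K r α β (rename (borderIndex r α β) q) = 0 := by
    have h1 : (aeval fun s => (genericProduct K r α β).rangeRestrict
        (X (borderIndex r α β s))) q =
        (genericProduct K r α β).rangeRestrict (rename (borderIndex r α β) q) := by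
      rw [← AlgHom.comp_apply]
      congr 1
      ext s
      simp
    rw [h1] at hq
    exact congrArg Subtype.val hq
  let D : MvPolynomial ((Fin r × (Fin r ⊕ β)) ⊕ (α × Fin r)) K :=
    (Matrix.of fun i j => X (Sum.inl (i, Sum.inl j))).det
  have hDeval : ∀ w, eval w D =
      (Matrix.of fun i j => w (Sum.inl (i, Sum.inl j)) : Matrix (Fin r) (Fin r) K).det := by
    intro w
    rw [RingHom.map_det]
    congr 1
    ext i j
    simp
  have hD : D ≠ 0 := by
    intro h0
    have h1 := hDeval (Sum.elim (fun p => Sum.elim (fun j => (1 : Matrix (Fin r) (Fin r) K) p.1 j)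
      (fun _ => 0) p.2) fun _ => 0)
    rw [h0, map_zero] at h1
    simp only [Sum.elim_inl] at h1
    have h2 : (Matrix.of fun i j => (1 : Matrix (Fin r) (Fin r) K) i j) = 1 := rfl
    rw [h2, Matrix.det_one] at h1
    exact zero_ne_one h1
  have hprod : q * D = 0 := by
    refine MvPolynomial.funext fun w => ?_
    rw [map_mul, hDeval, map_zero]
    set E : Matrix (Fin r) (Fin r) K := Matrix.of fun i j => w (Sum.inl (i, Sum.inl j)) with hE
    by_cases hdet : E.det = 0
    · rw [hdet, mul_zero]
    let G : Matrix α (Fin r) K := Matrix.of fun i j => w (Sum.inr (i, j))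
    have hG : G * E⁻¹ * E = G := by
      rw [Matrix.mul_assoc, Matrix.nonsing_inv_mul _ (isUnit_iff_ne_zero.2 hdet), Matrix.mul_one]
    -- The left factor is the identity stacked on `G * E⁻¹`, the right factor the prescribed first
    -- `r` rows.
    let pt : ((Fin r ⊕ α) × Fin r) ⊕ (Fin r × (Fin r ⊕ β)) → K :=
      Sum.elim (fun p => Sum.elim (fun i => (1 : Matrix (Fin r) (Fin r) K) i p.2)
        (fun i => (G * E⁻¹) i p.2) p.1) (fun p => w (Sum.inl p))
    have hpt : eval pt (genericProduct K r α β (rename (borderIndex r α β) q)) = eval w q := by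
      have hcomp : ((aeval pt).comp (genericProduct K r α β)).comp (rename (borderIndex r α β)) =
          aeval w := by
        ext s
        rcases s with ⟨i, j⟩ | ⟨i, j⟩
        · simp [genericProduct, borderIndex, pt, Matrix.one_apply]
        · have := congrFun (congrFun hG i) j
          rw [Matrix.mul_apply] at this
          simpa [genericProduct, borderIndex, pt, E, G] using this
      have := DFunLike.congr_fun hcomp q
      simpa [aeval_eq_eval] using this
    rw [← hpt, hq', map_zero, zero_mul]
  exact (mul_eq_zero.1 hprod).resolve_right hD

attribute [local instance] MvPolynomial.gradedAlgebra

variable {K r α β}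

/-- A linear space of matrices without nonzero elements of rank at most `r` has dimension at most
the codimension of the determinantal variety. -/
lemma finrank_le_of_forall_rank_le [IsAlgClosed K] [Fintype α] [Fintype β]
    (T : Submodule K ((Fin r ⊕ α) × (Fin r ⊕ β) → K))
    (hT : ∀ x ∈ T, (Matrix.of fun i j => x (i, j)).rank ≤ r → x = 0) :
    Module.finrank K T ≤ Fintype.card α * Fintype.card β := by
  classical
  have hI : (Ideal.span (Set.range (genericMinor K r α β))).IsHomogeneous
      (homogeneousSubmodule ((Fin r ⊕ α) × (Fin r ⊕ β)) K) := by
    refine Ideal.homogeneous_span _ _ ?_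
    rintro _ ⟨p, rfl⟩
    exact ⟨r + 1, isHomogeneous_genericMinor K r α β p⟩
  have hker : Ideal.span (Set.range (genericMinor K r α β)) ≤
      RingHom.ker (genericProduct K r α β).rangeRestrict := by
    rw [Ideal.span_le]
    rintro _ ⟨p, rfl⟩
    exact Subtype.ext (genericProduct_genericMinor K r α β p)
  have h1 := trdeg_add_finrank_le (genericProduct K r α β).rangeRestrict
    (AlgHom.rangeRestrict_surjective _) hI hker T fun x hx hx0 => by
      refine hT x hx ?_
      by_contra! hlt
      obtain ⟨g, h, hne⟩ := exists_minor_ne_zero _ (Nat.succ_le_of_lt hlt)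
      refine hne ?_
      have := hx0 _ (Ideal.subset_span ⟨(g, h), rfl⟩)
      rw [genericMinor, RingHom.map_det] at this
      rw [← this]
      congr 1
      ext i j
      simp
  have := IsAlgClosed.instInfinite (K := K)
  have h2 := (algebraicIndependent_border K r α β).cardinalMk_le_trdeg
  have h3 := (add_le_add_left h2 _).trans h1
  rw [Cardinal.mk_fintype] at h3
  norm_cast at h3
  simp only [Fintype.card_sum, Fintype.card_prod, Fintype.card_fin] at h3
  -- With `p = |α|` and `q = |β|`: `(r + p)(r + q) - r(r + q) - pr = pq`.
  nlinarith

end Determinantal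

/-! ### Consequences for the generators and for arbitrary subspaces -/

lemma linearIndependent_gen {m n : ℕ} {a : ℝ} (ha : 3 ≤ a) :
    LinearIndependent ℂ (fun p : indexSet m n => gen m n a p) := by
  classical
  rw [linearIndependent_iff']
  intro s g hg p hp
  by_contra hne
  have h := three_lt_rank_sum_gen (m := m) (n := n) ha (s.map (Function.Embedding.subtype _))
    (fun q hq => by
      obtain ⟨q', -, rfl⟩ := Finset.mem_map.1 hq
      exact q'.2)
    (fun q => if hq : q ∈ indexSet m n then g ⟨q, hq⟩ else 0)
    ⟨p, Finset.mem_map.2 ⟨p, hp, rfl⟩, by simpa using hne⟩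
  have h0 : ∑ q ∈ s.map (Function.Embedding.subtype _),
      (if hq : q ∈ indexSet m n then g ⟨q, hq⟩ else 0) • gen m n a q = 0 := by
    rw [Finset.sum_map, ← hg]
    exact Finset.sum_congr rfl fun q _ => by simp
  rw [h0, map_zero, Matrix.rank_zero] at h
  omega

lemma not_schmidtRank_le_three {m n : ℕ} {a : ℝ} (ha : 3 ≤ a) {ψ : Bipartite m n}
    (hψ : ψ ∈ subspaceS m n a) (h0 : ψ ≠ 0) : ¬ schmidtRank ψ ≤ 3 := by
  rw [schmidtRank_eq_rank, not_le]
  obtain ⟨l, hl, rfl⟩ := (Finsupp.mem_span_image_iff_linearCombination ℂ).1 hψ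
  rw [Finsupp.linearCombination_apply, Finsupp.sum] at h0 ⊢
  refine three_lt_rank_sum_gen ha _ (fun p hp => (Finsupp.mem_supported ℂ l).1 hl hp) l ?_
  by_contra! h
  exact h0 (Finset.sum_eq_zero fun p hp => by rw [h p hp, zero_smul])

lemma schmidtRank_gen {m n : ℕ} {a : ℝ} (ha : 3 ≤ a) {p : ℕ × ℕ} (hp : p ∈ indexSet m n) :
    schmidtRank (gen m n a p) = 4 := by
  rw [schmidtRank_eq_rank]
  apply le_antisymm
  · have h : gen m n a p = ∑ j : Fin 4,
        (![ket m (p.1 - 2), -((a : ℂ) • ket m (p.1 - 1)), (a : ℂ) • ket m p.1,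
          -ket m (p.1 + 1)] j) ⊗ₜ[ℂ]
        (![ket n (p.2 + 1), ket n p.2, ket n (p.2 - 1), ket n (p.2 - 2)] j) := by
      simp [Fin.sum_univ_four, gen, TensorProduct.neg_tmul, TensorProduct.smul_tmul',
        sub_eq_add_neg]
    rw [h]
    exact rank_coeffMatrix_sum_tmul_le _ _
  · have h := three_lt_rank_sum_gen ha {p} (by simpa using hp) (fun _ => 1)
      ⟨p, by simp, one_ne_zero⟩
    rw [Finset.sum_singleton, one_smul] at h
    exact h

lemma finrank_subspaceS {m n : ℕ} (hm : 4 ≤ m) (hn : 4 ≤ n) {a : ℝ} (ha : 3 ≤ a) :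
    Module.finrank ℂ (subspaceS m n a) = (m - 3) * (n - 3) := by
  let s : Finset (ℕ × ℕ) := Finset.Icc 2 (m - 2) ×ˢ Finset.Icc 2 (n - 2)
  have hs : ∀ p, p ∈ s ↔ p ∈ indexSet m n := by
    intro p
    simp only [s, Finset.mem_product, Finset.mem_Icc, indexSet, Set.mem_ofPred_eq]
    omega
  let _ : Fintype (indexSet m n) := Fintype.ofFinset s hs
  rw [subspaceS, Set.image_eq_range, finrank_span_eq_card (linearIndependent_gen ha),
    Fintype.card_ofFinset, Finset.card_product, Nat.card_Icc, Nat.card_Icc]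
  congr 1

/-- The components are spanned by disjoint parts of a linearly independent family. -/
lemma iSupIndep_component {m n : ℕ} {a : ℝ} (ha : 3 ≤ a) :
    iSupIndep (fun d : Fin (m + n - 1) => component m n a d) := by
  have himage : ∀ P : ℕ × ℕ → Prop, gen m n a '' {p ∈ indexSet m n | P p} =
      (fun p : indexSet m n => gen m n a p) '' {p | P p} := by
    intro P
    ext ψ
    constructor
    · rintro ⟨p, ⟨hp, hP⟩, rfl⟩
      exact ⟨⟨p, hp⟩, hP, rfl⟩
    · rintro ⟨p, hP, rfl⟩
      exact ⟨p, ⟨p.2, hP⟩, rfl⟩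
  intro d
  have hle : ⨆ (d' : Fin (m + n - 1)) (_ : d' ≠ d), component m n a d' ≤
      Submodule.span ℂ (gen m n a '' {p ∈ indexSet m n | p.1 + p.2 ≠ d + 1}) := by
    refine iSup₂_le fun d' hd' => Submodule.span_mono (Set.image_mono fun p hp => ⟨hp.1, ?_⟩)
    rw [hp.2]
    exact fun h => hd' (Fin.ext (by omega))
  refine Disjoint.mono_right hle ?_
  simp only [component]
  rw [himage, himage]
  refine (linearIndependent_gen ha).disjoint_span_image ?_
  rw [Set.disjoint_left]
  exact fun p hp hp' => hp' hp

lemma subspaceS_eq_iSup_component (m n : ℕ) (a : ℝ) :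
    subspaceS m n a = ⨆ d : Fin (m + n - 1), component m n a d := by
  apply le_antisymm
  · refine Submodule.span_le.2 ?_
    rintro _ ⟨p, hp, rfl⟩
    obtain ⟨h1, h2, h3, h4⟩ := id hp
    refine Submodule.mem_iSup_of_mem ⟨p.1 + p.2 - 1, by omega⟩
      (Submodule.subset_span ⟨p, ⟨hp, ?_⟩, rfl⟩)
    change p.1 + p.2 = p.1 + p.2 - 1 + 1
    omega
  · exact iSup_le fun d => Submodule.span_mono (Set.image_mono fun p hp => hp.1)

lemma finrank_le_of_forall_not_schmidtRank_le {m n r : ℕ} (hm : r ≤ m) (hn : r ≤ n)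
    (T : Submodule ℂ (Bipartite m n)) (hT : ∀ ψ ∈ T, ψ ≠ 0 → ¬ schmidtRank ψ ≤ r) :
    Module.finrank ℂ T ≤ (m - r) * (n - r) := by
  -- Splitting off the first `r` indices matches the block form of the determinantal bound and
  -- leaves rank unchanged.
  let e₁ : Fin r ⊕ Fin (m - r) ≃ Fin m := finSumFinEquiv.trans (finCongr (by omega))
  let e₂ : Fin r ⊕ Fin (n - r) ≃ Fin n := finSumFinEquiv.trans (finCongr (by omega))
  let e : Matrix (Fin m) (Fin n) ℂ ≃ₗ[ℂ] ((Fin r ⊕ Fin (m - r)) × (Fin r ⊕ Fin (n - r)) → ℂ) :=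
    (LinearEquiv.curry ℂ ℂ (Fin m) (Fin n)).symm ≪≫ₗ
      LinearEquiv.funCongrLeft ℂ ℂ (e₁.prodCongr e₂)
  have he : ∀ M, (Matrix.of fun i j => e M (i, j)) = M.submatrix e₁ e₂ := fun M => rfl
  have h := finrank_le_of_forall_rank_le (T.map (coeffMatrix m n ≪≫ₗ e).toLinearMap) fun x hx => by
    obtain ⟨ψ, hψ, rfl⟩ := hx
    intro hrank
    by_contra hne
    refine hT ψ hψ (fun h0 => hne (by rw [h0, map_zero])) ?_
    rw [schmidtRank_eq_rank, ← Matrix.rank_submatrix _ e₁ e₂, ← he]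
    exact hrank
  rw [LinearEquiv.finrank_map_eq] at h
  simpa using h

end SchmidtSubspace

end

theorem mainTheorem1 (m n : ℕ) (hm : 4 ≤ m) (hn : 4 ≤ n) (a : ℝ) (ha : a = 3 ∨ 5 < a) :
    -- `S` is the direct sum of the `S^(d)`, `0 ≤ d ≤ m + n - 2`
    (iSupIndep (fun d : Fin (m + n - 1) => SchmidtSubspace.component m n a d) ∧
      SchmidtSubspace.subspaceS m n a =
        ⨆ d : Fin (m + n - 1), SchmidtSubspace.component m n a d) ∧
    -- `S` contains no nonzero vector of Schmidt rank at most `3`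
    (∀ ψ ∈ SchmidtSubspace.subspaceS m n a, ψ ≠ 0 → ¬ SchmidtSubspace.schmidtRank ψ ≤ 3) ∧
    -- the generators are linearly independent, and `dim S = (m - 3)(n - 3)`
    LinearIndependent ℂ
      (fun p : SchmidtSubspace.indexSet m n => SchmidtSubspace.gen m n a p) ∧
    Module.finrank ℂ (SchmidtSubspace.subspaceS m n a) = (m - 3) * (n - 3) ∧
    -- this is the maximal dimension of a subspace without nonzero vectors of Schmidt rank `≤ 3`
    (∀ T : Submodule ℂ (SchmidtSubspace.Bipartite m n),
      (∀ ψ ∈ T, ψ ≠ 0 → ¬ SchmidtSubspace.schmidtRank ψ ≤ 3) →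
        Module.finrank ℂ T ≤ (m - 3) * (n - 3)) ∧
    -- every generator has Schmidt rank exactly `4`
    (∀ p ∈ SchmidtSubspace.indexSet m n,
      SchmidtSubspace.schmidtRank (SchmidtSubspace.gen m n a p) = 4) := by
  have ha3 : 3 ≤ a := by rcases ha with rfl | h <;> linarith
  exact ⟨⟨SchmidtSubspace.iSupIndep_component ha3,
      SchmidtSubspace.subspaceS_eq_iSup_component m n a⟩,
    fun ψ hψ h0 => SchmidtSubspace.not_schmidtRank_le_three ha3 hψ h0,
    SchmidtSubspace.linearIndependent_gen ha3,
    SchmidtSubspace.finrank_subspaceS hm hn ha3,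
    fun T hT => SchmidtSubspace.finrank_le_of_forall_not_schmidtRank_le
      (by omega) (by omega) T hT,
    fun p hp => SchmidtSubspace.schmidtRank_gen ha3 hp⟩
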